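/- **Setting.** A system $S$ and environments $E_1,\dots,E_N$ are particles on the line $\mathbb R$, described relative to a laboratory $C$. Positions are continuous; states may be normalised wave functions $|\psi\rangle=\int dx\,\psi(x)|x\rangle$ with $\psi\in L^2(\mathbb R)$, or superpositions $\sum_x\psi(x)|x\rangle$ with $\psi\in\ell^2(\mathbb R)$ of position eigenstates, which obey $\langle x|x'\rangle=0$ for $x\ne x'$ and $\langle x|x\rangle=1$ (wave functions of different kinds are orthogonal). Accordingly, a density matrix with position kernel $\rho(x,x')$ is understood through its characteristic function $\chi_\rho(a,b)=\operatorname{Tr}(\rho\,e^{iaX}T_b)=\int e^{iax}\rho(x-b,x)\,dx$, $(T_b\psi)(x)=\psi(x-b)$, which is required to be positive (as an expectation functional) and to have a probability measure on $\mathbb R$ as its position distribution; this includes localised states $|x\rangle\langle x|$, trace-class kernels and incoherent mixtures $\int f(x)|x\rangle\langle x|dx$. Two such states $\rho,\rho'$ are perfectly distinguishable if for each $\varepsilon>0$ there is an effect $0\le A\le 1$ (a finite combination of the operators $e^{iaX}T_b$) with $\operatorname{Tr}(\rho A)\ge 1-\varepsilon$ and $\operatorname{Tr}(\rho' A)\le\varepsilon$;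 for density operators this means $\rho\rho'=0$. Let $p$ be a probability measure on a measurable space $I$ (discrete or continuous; $p(di)=p_i\,di$). A *continuous SBS state* with objective information $(I,p)$ is $$\rho=\int p(di)\,\rho_{|i},\qquad \rho_{|i}=|\psi_i^S\rangle\langle\psi_i^S|_S\otimes\bigotimes_{j=1}^N\rho_{E_j|i},$$ whose conditional states depend measurably on $i$ and satisfy, for all $i\neq i'$ outside a $p$-null set, $\langle\psi_i^S|\psi_{i'}^S\rangle=0$ and, for every $j$, $\rho_{E_j|i}$ and $\rho_{E_j|i'}$ are perfectly distinguishable. In the reference frame of $E_k$ the subsystems are $S$, $C$ and $E_j$ ($j\ne k$), and a state with kernel $\rho(x,x')$ has the kernel $\rho^{(E_k)}(q,q')=\rho(Mq,Mq')$, where $x=Mq$ is given by $x_S=q_S-q_C$, $x_{E_k}=-q_C$, $x_{E_j}=q_{E_j}-q_C$. In the frame $C$, $\rho^{(C)}=\rho$. The state $\rho$ is *perfectly objective in the frame $F$ with the same objective information* if $\rho^{(F)}$ is an SBS state $\int p(di)\,|\tilde\psi_i\rangle\langle\tilde\psi_i|_S\otimes\bigotimes_{X}\tilde\rho_{X|i}$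 (with $X$ ranging over the other subsystems in the frame $F$) with the same index $i$ and the same $p$, that is, for $p$-almost every $i$ the conditional state $\rho_{|i}$, described in the frame $F$, equals $|\tilde\psi_i\rangle\langle\tilde\psi_i|_S\otimes\bigotimes_X\tilde\rho_{X|i}$. **Corollary.** A continuous SBS state is perfectly objective with the same objective information in the laboratory frame $C$ and in all environment frames $E_1,\dots,E_N$ if and only if there are measurable functions $i\mapsto x_{E_j|i}\in\mathbb R$ ($1\le j\le N$) such that $$\rho=\int p(di)\,|\psi_i^S\rangle\langle\psi_i^S|_S\otimes\bigotimes_{j=1}^N|x_{E_j|i}\rangle\langle x_{E_j|i}|_{E_j}$$ (with equality of the conditional states for $p$-almost every $i$) and, for all $i\ne i'$ outside a $p$-null set, $$\langle\psi_i^S|\psi_{i'}^S\rangle=0,\qquad \langle x_{E_j|i}|x_{E_j|i'}\rangle=0\ \ \forall j,$$ $$\langle\tilde\psi_{i,j}^S|\tilde\psi_{i',j}^S\rangle=0\ \ \forall j,\qquad \langle x_{E_j|i}-x_{E_k|i}\,|\,x_{E_j|i'}-x_{E_k|i'}\rangle=0\ \ \forall j\ne k,$$ where $\tilde\psi_{i,j}^S(q)=\psi_i^S(q+x_{E_j|i})$.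 -/

import Mathlib

open MeasureTheory
open scoped ComplexOrder ComplexConjugate

noncomputable section

namespace QRF

/-! ## One particle on a line

A density matrix with position kernel `ρ(x, x')` is represented by its characteristic function,
i.e. by the expectation values of the operators `e^{i a X} T_b`, where `(T_b ψ)(x) = ψ(x - b)`:
`χ(a, b) = Tr (ρ e^{i a X} T_b) = ∫ e^{i a x} ρ(x - b, x) dx`.
This is the Fourier transform of the kernel `ρ(x, x')` along its off-diagonals, and it makes sense
for localised states `|x⟩⟨x|`, for square-integrable kernels and for incoherent mixtures
`∫ f(x) |x⟩⟨x| dx` alike. -/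

/-- A (generalised) density matrix of a particle on the line, given by its characteristic function
`χ`.  It is positive, `⟨A* A⟩ ≥ 0` for every finite combination `A = ∑ c_k e^{i a_k X} T_{b_k}`
(note `(e^{iaX} T_b)* (e^{ia'X} T_{b'}) = e^{i(a'-a)b} e^{i(a'-a)X} T_{b'-b}`),
and its position distribution is a probability measure (in particular it has trace one). -/
structure Density where
  χ : ℝ → ℝ → ℂ
  law : ∃ μ : Measure ℝ, IsProbabilityMeasure μ ∧
    ∀ a : ℝ, χ a 0 = ∫ x : ℝ, Complex.exp (Complex.I * (a * x)) ∂μ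
  pos : ∀ (n : ℕ) (c : Fin n → ℂ) (a b : Fin n → ℝ),
    0 ≤ ∑ k, ∑ l, conj (c k) * c l * Complex.exp (Complex.I * ((a l - a k) * b k)) *
      χ (a l - a k) (b l - b k)

/-- The expectation value in the state `ρ` of the observable `A = ∑ A(a,b) e^{i a X} T_b`
(a finite sum). -/
def Density.expect (ρ : Density) (A : (ℝ × ℝ) →₀ ℂ) : ℂ :=
  A.sum fun p c => c * ρ.χ p.1 p.2

/-- `A` is an effect (an element of a quantum measurement): `0 ≤ A ≤ 1`. -/
def IsEffect (A : (ℝ × ℝ) →₀ ℂ) : Prop :=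
  ∀ σ : Density, 0 ≤ σ.expect A ∧ σ.expect A ≤ 1

/-- Perfect distinguishability of two states: measurements tell them apart with arbitrarily small
error probability.  For trace-class density operators this says `ρ ρ' = 0`, equivalently
`Tr (ρ ρ') = 0`. -/
def Distinguishable (ρ ρ' : Density) : Prop :=
  ∀ ε : ℝ, 0 < ε → ∃ A, IsEffect A ∧ 1 - ε ≤ (ρ.expect A).re ∧ (ρ'.expect A).re ≤ ε

/-- A normalised pure state of a particle on the line, in one of the two usual forms:
`|ψ⟩ = ∫ dx ψ(x) |x⟩` with `ψ` square-integrable (`base = volume`), or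
`|ψ⟩ = ∑ₓ ψ(x) |x⟩` with `ψ` square-summable (`base = count`). -/
structure Wave where
  base : Measure ℝ
  base_eq : base = volume ∨ base = Measure.count
  ψ : ℝ → ℂ
  memLp : MemLp ψ 2 base
  norm_one : ∫ x, ‖ψ x‖ ^ 2 ∂base = 1

/-- The inner product `⟨φ|ψ⟩`.  A square-integrable wave function and a countable superposition
of position eigenstates are orthogonal. -/
def overlap (φ ψ : Wave) : ℂ :=
  open Classical in if φ.base = ψ.base then ∫ x, conj (φ.ψ x) * ψ.ψ x ∂φ.base else 0

instance Wave.base_isAddRightInvariant (w : Wave) : w.base.IsAddRightInvariant := by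
  rcases w.base_eq with h | h <;> rw [h] <;> infer_instance

/-- The translated wave function `q ↦ ψ(q + c)`. -/
def Wave.shift (w : Wave) (c : ℝ) : Wave where
  base := w.base
  base_eq := w.base_eq
  ψ := fun q => w.ψ (q + c)
  memLp := w.memLp.comp_measurePreserving (measurePreserving_add_right w.base c)
  norm_one := by
    rw [integral_add_right_eq_self (fun x => ‖w.ψ x‖ ^ 2) c]
    exact w.norm_one

theorem memLp_ket (x : ℝ) : MemLp (Pi.single x 1 : ℝ → ℂ) 2 Measure.count := by
  have h : (Pi.single x 1 : ℝ → ℂ) = Set.indicator {x} (fun _ => 1) := by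
    funext y
    by_cases hy : y = x
    · subst hy; simp
    · simp [hy]
  rw [h]
  refine memLp_indicator_const 2 (measurableSet_singleton x) 1 (Or.inr ?_)
  simp

/-- The position eigenstate `|x⟩`. -/
def ket (x : ℝ) : Wave where
  base := Measure.count
  base_eq := Or.inr rfl
  ψ := Pi.single x 1
  memLp := memLp_ket x
  norm_one := by
    have h : (fun y => ‖(Pi.single x 1 : ℝ → ℂ) y‖ ^ 2) = Set.indicator {x} (fun _ => (1 : ℝ)) := by
      funext y
      by_cases hy : y = x
      · subst hy; simp
      · simp [hy]
    rw [h, integral_indicator (measurableSet_singleton x)]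
    simp

/-- The characteristic function of `|ψ⟩⟨ψ|`, whose kernel is `ψ(x) ψ*(x')`. -/
def Wave.χ (w : Wave) (a b : ℝ) : ℂ :=
  ∫ x : ℝ, Complex.exp (Complex.I * (a * x)) * (w.ψ (x - b) * conj (w.ψ x)) ∂w.base

theorem norm_exp_I_mul (a x : ℝ) : ‖Complex.exp (Complex.I * (a * x))‖ = 1 := by
  rw [mul_comm, ← Complex.ofReal_mul, Complex.norm_exp_ofReal_mul_I]

theorem Wave.memLp_displaced (w : Wave) (a b : ℝ) :
    MemLp (fun x : ℝ => Complex.exp (Complex.I * (a * x)) * w.ψ (x - b)) 2 w.base := by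
  have h1 : MemLp (fun x => w.ψ (x - b)) 2 w.base := by
    simp only [sub_eq_add_neg]
    exact (w.shift (-b)).memLp
  refine h1.of_le (AEStronglyMeasurable.mul ?_ h1.1) (Filter.Eventually.of_forall fun x => ?_)
  · exact (by fun_prop : Measurable fun x : ℝ =>
      Complex.exp (Complex.I * (a * x))).aestronglyMeasurable
  · rw [norm_mul, norm_exp_I_mul, one_mul]

theorem Wave.integrable_displaced (w : Wave) (a a' b b' : ℝ) :
    Integrable (fun x : ℝ => conj (Complex.exp (Complex.I * (a * x)) * w.ψ (x - b)) *
      (Complex.exp (Complex.I * (a' * x)) * w.ψ (x - b'))) w.base := by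
  have h := (w.memLp_displaced a b).star.integrable_mul (w.memLp_displaced a' b')
  exact h

theorem Wave.χ_displaced (w : Wave) (a a' b b' : ℝ) :
    Complex.exp (Complex.I * ((a' - a) * b)) * w.χ (a' - a) (b' - b) =
      ∫ x : ℝ, conj (Complex.exp (Complex.I * (a * x)) * w.ψ (x - b)) *
        (Complex.exp (Complex.I * (a' * x)) * w.ψ (x - b')) ∂w.base := by
  rw [Wave.χ, ← integral_const_mul,
    ← integral_add_right_eq_self (fun x : ℝ => conj (Complex.exp (Complex.I * (a * x)) * w.ψ (x - b)) *
        (Complex.exp (Complex.I * (a' * x)) * w.ψ (x - b'))) b]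
  congr 1
  funext x
  have e : Complex.exp (Complex.I * ((a' - a) * b)) * Complex.exp (Complex.I * ((a' - a) * x)) =
      conj (Complex.exp (Complex.I * (a * (x + b)))) * Complex.exp (Complex.I * (a' * (x + b))) := by
    rw [← Complex.exp_conj, ← Complex.exp_add, ← Complex.exp_add]
    congr 1
    simp
    ring
  have e1 : x - (b' - b) = x + b - b' := by ring
  have e2 : x + b - b = x := by ring
  simp only [map_mul]
  push_cast
  rw [e1, e2, ← mul_assoc, e]
  ring

/-- The pure state `|ψ⟩⟨ψ|`. -/
def Wave.proj (w : Wave) : Density where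
  χ := w.χ
  law := by
    have hi : Integrable (fun x => ‖w.ψ x‖ ^ 2) w.base := w.memLp.integrable_norm_pow (by norm_num)
    have hm : AEMeasurable (fun x => (‖w.ψ x‖₊ ^ 2 : NNReal)) w.base :=
      (w.memLp.1.nnnorm.pow 2).aemeasurable
    refine ⟨w.base.withDensity (fun x => ((‖w.ψ x‖₊ ^ 2 : NNReal) : ENNReal)), ⟨?_⟩, fun a => ?_⟩
    · rw [withDensity_apply _ MeasurableSet.univ, Measure.restrict_univ]
      have := ofReal_integral_eq_lintegral_ofReal hi
        (Filter.Eventually.of_forall fun x => by positivity)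
      rw [w.norm_one, ENNReal.ofReal_one] at this
      rw [this]
      congr 1
      funext x
      rw [ENNReal.ofReal]
      congr 1
      rw [← NNReal.coe_inj, Real.coe_toNNReal _ (by positivity)]
      simp
    · rw [integral_withDensity_eq_integral_smul₀ hm, Wave.χ]
      congr 1
      funext x
      rw [sub_zero, Complex.mul_conj, Complex.normSq_eq_norm_sq, NNReal.smul_def]
      simp [mul_comm]
  pos := by
    intro n c a b
    have key : ∑ k, ∑ l, conj (c k) * c l * Complex.exp (Complex.I * ((a l - a k) * b k)) *
        w.χ (a l - a k) (b l - b k) =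
        ∫ x : ℝ, ((‖∑ l, c l * (Complex.exp (Complex.I * (a l * x)) * w.ψ (x - b l))‖ ^ 2 : ℝ) : ℂ)
          ∂w.base := by
      have hpt : ∀ x : ℝ,
          ((‖∑ l, c l * (Complex.exp (Complex.I * (a l * x)) * w.ψ (x - b l))‖ ^ 2 : ℝ) : ℂ) =
          ∑ k, ∑ l, conj (c k) * c l *
            (conj (Complex.exp (Complex.I * (a k * x)) * w.ψ (x - b k)) *
              (Complex.exp (Complex.I * (a l * x)) * w.ψ (x - b l))) := by
        intro x
        rw [Complex.ofReal_pow, ← Complex.conj_mul', map_sum, Finset.sum_mul_sum]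
        refine Finset.sum_congr rfl fun k _ => Finset.sum_congr rfl fun l _ => ?_
        rw [map_mul]
        ring
      simp_rw [hpt]
      rw [integral_finsetSum _ fun k _ => integrable_finsetSum _ fun l _ =>
        (w.integrable_displaced (a k) (a l) (b k) (b l)).const_mul _]
      refine Finset.sum_congr rfl fun k _ => ?_
      rw [integral_finsetSum _ fun l _ =>
        (w.integrable_displaced (a k) (a l) (b k) (b l)).const_mul _]
      refine Finset.sum_congr rfl fun l _ => ?_
      rw [integral_const_mul, ← w.χ_displaced, mul_assoc]
    rw [key, integral_complex_ofReal]
    exact Complex.zero_le_real.mpr (integral_nonneg fun x => by positivity)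

/-! ## The joint system and its reference frames

In every frame there are `N + 1` subsystems, indexed by `Option (Fin N)`: the index `none` is the
system `S`, and `some j` is the environment `E_j`.  In the frame of `E_k`, where `E_k` itself no
longer appears, the index `some k` stands for the laboratory `C`. -/

/-- Joint density matrices, in the same representation as for one particle:
`χ(a, b) = ∫ e^{i a·x} ρ(x - b, x) dx` for `a`, `b` in `ℝ^{N+1}`. -/
abbrev JointKernel (N : ℕ) : Type :=
  (Option (Fin N) → ℝ) → (Option (Fin N) → ℝ) → ℂ

/-- The coordinate change between the laboratory and the frame of `E_k`, in both directions:
`(x_S, x_{E_k}, x_{E_j}) = (q_S - q_C, -q_C, q_{E_j} - q_C)`. -/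
def frameMap {N : ℕ} (k : Fin N) (q : Option (Fin N) → ℝ) : Option (Fin N) → ℝ :=
  fun s => if s = some k then -q (some k) else q s - q (some k)

/-- The transpose of `frameMap k`. -/
def frameMapT {N : ℕ} (k : Fin N) (a : Option (Fin N) → ℝ) : Option (Fin N) → ℝ :=
  fun s => if s = some k then -∑ r, a r else a s

theorem frameMap_frameMap {N : ℕ} (k : Fin N) (x : Option (Fin N) → ℝ) :
    frameMap k (frameMap k x) = x := by
  funext s
  by_cases h : s = some k
  · simp [frameMap, h]
  · simp [frameMap, h]

theorem frameMapT_dot {N : ℕ} (k : Fin N) (a x : Option (Fin N) → ℝ) :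
    ∑ s, frameMapT k a s * x s = ∑ s, a s * frameMap k x s := by
  have h1 : ∀ s, frameMap k x s = (if s = some k then 0 else x s) - x (some k) := by
    intro s; by_cases h : s = some k <;> simp [frameMap, h]
  have h2 : ∀ s, frameMapT k a s * x s = a s * (if s = some k then 0 else x s) +
      (if s = some k then -(∑ r, a r) * x (some k) else 0) := by
    intro s; by_cases h : s = some k <;> simp [frameMapT, h]
  simp_rw [h1, h2, Finset.sum_add_distrib, mul_sub, Finset.sum_sub_distrib, ← Finset.sum_mul]
  rw [Finset.sum_ite_eq' Finset.univ (some k)]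
  simp
  ring

/-- The joint state described in the reference frame `F`: the laboratory `C` for `F = none`, and
the environment `E_k` for `F = some k`.  With `M = frameMap k` the kernel becomes
`ρ'(q, q') = ρ(M q, M q')`, so that, as `M` is its own inverse and preserves volume,
`χ'(a, b) = ∫ e^{i a·q} ρ(M(q - b), M q) dq = ∫ e^{i (Mᵀ a)·x} ρ(x - M b, x) dx = χ(Mᵀ a, M b)`. -/
def toFrame {N : ℕ} : Option (Fin N) → JointKernel N → JointKernel N
  | none, χ => χ
  | some k, χ => fun a b => χ (frameMapT k a) (frameMap k b)

/-- A family of conditional states `|ψ_i⟩⟨ψ_i| ⊗ ρ_{1|i} ⊗ ⋯ ⊗ ρ_{N|i}`, indexed by `i : I`. -/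
structure Branches (I : Type*) (N : ℕ) where
  ψ : I → Wave
  ρ : I → Fin N → Density

variable {I : Type*} {N : ℕ}

/-- The joint conditional state `|ψ_i⟩⟨ψ_i| ⊗ ρ_{1|i} ⊗ ⋯ ⊗ ρ_{N|i}`. -/
def Branches.conditional (D : Branches I N) (i : I) : JointKernel N :=
  fun a b => (D.ψ i).proj.χ (a none) (b none) * ∏ j, (D.ρ i j).χ (a (some j)) (b (some j))

/-- The state `∫ p(di) |ψ_i⟩⟨ψ_i| ⊗ ρ_{1|i} ⊗ ⋯ ⊗ ρ_{N|i}`. -/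
def Branches.state [MeasurableSpace I] (D : Branches I N) (p : Measure I) : JointKernel N :=
  fun a b => ∫ i, D.conditional i a b ∂p

/-- `∫ p(di) |ψ_i⟩⟨ψ_i| ⊗ ρ_{1|i} ⊗ ⋯ ⊗ ρ_{N|i}` has spectrum broadcast structure: the conditional
states depend measurably on `i` and, apart from a `p`-null set of indices, the system states are
orthogonal and the states of each environment are perfectly distinguishable. -/
def Branches.IsSBS [MeasurableSpace I] (D : Branches I N) (p : Measure I) : Prop :=
  (∀ a b : ℝ, AEMeasurable (fun i => (D.ψ i).proj.χ a b) p) ∧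
  (∀ (j : Fin N) (a b : ℝ), AEMeasurable (fun i => (D.ρ i j).χ a b) p) ∧
  ∃ G ∈ ae p, ∀ i ∈ G, ∀ i' ∈ G, i ≠ i' →
    overlap (D.ψ i) (D.ψ i') = 0 ∧ ∀ j, Distinguishable (D.ρ i j) (D.ρ i' j)

/-- In the frame `F`, the state given by `D` is again of spectrum broadcast structure with the same
objective information, i.e. with the same index `i`, distributed according to the same `p`:
conditional on `i`, the state in the frame `F` is `|ψ'_i⟩⟨ψ'_i| ⊗ ρ'_{1|i} ⊗ ⋯ ⊗ ρ'_{N|i}`,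
with orthogonal resp. distinguishable factors. -/
def Branches.ObjectiveIn [MeasurableSpace I] (D : Branches I N) (p : Measure I)
    (F : Option (Fin N)) : Prop :=
  ∃ D' : Branches I N, D'.IsSBS p ∧ toFrame F (D.state p) = D'.state p ∧
    ∀ᵐ i ∂p, toFrame F (D.conditional i) = D'.conditional i

/-- The family of conditional states
`|ψ_i⟩⟨ψ_i| ⊗ |x_{1|i}⟩⟨x_{1|i}| ⊗ ⋯ ⊗ |x_{N|i}⟩⟨x_{N|i}|`. -/
def Branches.localised (ψ : I → Wave) (x : Fin N → I → ℝ) : Branches I N where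
  ψ := ψ
  ρ := fun i j => (ket (x j i)).proj

end QRF

end

/-!
In the frame of `E_k` the system and the laboratory sit at `x_S - x_k` and `-x_k`. If the conditional
state is a product both in the laboratory and in this frame, these two positions are independent, and
comparing characteristic functions of the position distributions gives
`φ_S(s) φ_k(-(s + t)) = φ_S(s) φ_k(-s) φ_k(-t)`. As `φ_S` does not vanish near `0`, the choice
`t = -s` yields `|φ_k(s)| = 1` for all small `s`, so the position of `E_k` is sharp
(`exists_charFun_eq_cexp`). Positivity then makes the state of `E_k` multiplicative on the operators
`e^{iaX}`, and the Weyl relations leave only the position eigenstate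
(`Density.χ_eq_ket_of_sharp_position`, `Branches.exists_position_of_toFrame_eq`). The position is a
limit of multiples of arguments of `χ`, hence measurable in `i`
(`exists_measurable_position`).

Once all environments are localised, the conditional state in the frame of `E_k` is explicit
(`Branches.toFrame_localised`): the system is shifted by `x_k`, the laboratory is at `-x_k` and `E_j`
at `x_j - x_k`. Its factors are determined by the product (`Branches.factors_eq_of_conditional_eq`),
so the frame `E_k` is objective exactly when the shifted system states are orthogonal and the
positions separate the indices. Two facts translate between states and wave functions: equality of
the characteristic functions `χ` of two pure states means equality of the wave functions up to a phase
(`Wave.exists_ae_eq_const_mul_of_χ_eq`), so orthogonality can be read off from the projections; and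
position eigenstates are perfectly distinguishable exactly when their positions differ
(`distinguishable_ket`, `Distinguishable.ne`).
-/

noncomputable section

namespace QRF

open Filter Topology

/-! ### Fourier uniqueness -/

theorem integral_cexp_eq_charFun (μ : Measure ℝ) (a : ℝ) :
    ∫ x : ℝ, Complex.exp (Complex.I * (a * x)) ∂μ = charFun μ a := by
  rw [charFun_apply_real]
  simp only [mul_comm Complex.I]

theorem integrable_cexp_mul {ν : Measure ℝ} {f : ℝ → ℂ} (hf : Integrable f ν) (a : ℝ) :
    Integrable (fun x : ℝ => Complex.exp (Complex.I * (a * x)) * f x) ν := by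
  refine hf.bdd_mul (c := 1) ?_ (Eventually.of_forall fun x => (norm_exp_I_mul a x).le)
  exact (by fun_prop : Measurable fun x : ℝ =>
    Complex.exp (Complex.I * (a * x))).aestronglyMeasurable

/-- The positive and the negative part of `u` are densities of finite measures with equal
characteristic functions. No σ-finiteness is needed, so `ν` may be the counting measure. -/
theorem ae_eq_zero_of_integral_cexp_mul_ofReal_eq_zero {ν : Measure ℝ} {u : ℝ → ℝ}
    (hu : Integrable u ν)
    (h : ∀ a : ℝ, ∫ x : ℝ, Complex.exp (Complex.I * (a * x)) * (u x : ℂ) ∂ν = 0) :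
    u =ᵐ[ν] 0 := by
  have hchar : ∀ v : ℝ → ℝ, Integrable v ν → ∀ a : ℝ,
      charFun (ν.withDensity fun x => ENNReal.ofReal (v x)) a =
        ∫ x : ℝ, Complex.exp (Complex.I * (a * x)) * ((max (v x) 0 : ℝ) : ℂ) ∂ν := by
    intro v hv a
    rw [← integral_cexp_eq_charFun, integral_withDensity_eq_integral_toReal_smul₀
      hv.1.aemeasurable.ennreal_ofReal (Eventually.of_forall fun x => ENNReal.ofReal_lt_top)]
    congr 1
    funext x
    rw [ENNReal.toReal_ofReal', Complex.real_smul, mul_comm]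
  have : IsFiniteMeasure (ν.withDensity fun x => ENNReal.ofReal (u x)) :=
    isFiniteMeasure_withDensity_ofReal hu.2
  have : IsFiniteMeasure (ν.withDensity fun x => ENNReal.ofReal (-u x)) :=
    isFiniteMeasure_withDensity_ofReal hu.neg.2
  have hμ : ν.withDensity (fun x => ENNReal.ofReal (u x)) =
      ν.withDensity fun x => ENNReal.ofReal (-u x) := by
    have hp : Integrable (fun x => ((max (u x) 0 : ℝ) : ℂ)) ν := hu.pos_part.ofReal
    have hn : Integrable (fun x => ((max (-u x) 0 : ℝ) : ℂ)) ν := hu.neg_part.ofReal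
    refine Measure.ext_of_charFun (funext fun a => sub_eq_zero.mp ?_)
    rw [hchar u hu a, hchar (fun x => -u x) hu.neg a,
      ← integral_sub (integrable_cexp_mul hp a) (integrable_cexp_mul hn a), ← h a]
    congr 1
    funext x
    rw [← mul_sub, ← Complex.ofReal_sub, max_zero_sub_max_neg_zero_eq_self]
  have hae := (withDensity_eq_iff hu.1.aemeasurable.ennreal_ofReal
    hu.neg.1.aemeasurable.ennreal_ofReal hu.lintegral_lt_top.ne).mp hμ
  filter_upwards [hae] with x hx
  have h1 := congrArg ENNReal.toReal hx
  rw [ENNReal.toReal_ofReal', Pi.neg_apply, ENNReal.toReal_ofReal'] at h1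
  have h2 := max_zero_sub_max_neg_zero_eq_self (u x)
  rw [Pi.zero_apply, ← h2, h1, sub_self]

theorem ae_eq_of_integral_cexp_mul_eq {ν : Measure ℝ} {f g : ℝ → ℂ}
    (hf : Integrable f ν) (hg : Integrable g ν)
    (h : ∀ a : ℝ, ∫ x : ℝ, Complex.exp (Complex.I * (a * x)) * f x ∂ν =
      ∫ x : ℝ, Complex.exp (Complex.I * (a * x)) * g x ∂ν) :
    f =ᵐ[ν] g := by
  have hd : Integrable (fun x => f x - g x) ν := hf.sub hg
  have h0 : ∀ a : ℝ, ∫ x : ℝ, Complex.exp (Complex.I * (a * x)) * (f x - g x) ∂ν = 0 := by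
    intro a
    simp only [mul_sub]
    rw [integral_sub (integrable_cexp_mul hf a) (integrable_cexp_mul hg a), h a, sub_self]
  have h0' : ∀ a : ℝ,
      ∫ x : ℝ, Complex.exp (Complex.I * (a * x)) * conj (f x - g x) ∂ν = 0 := by
    intro a
    have := congrArg conj (h0 (-a))
    rw [← integral_conj, map_zero] at this
    rw [← this]
    congr 1
    funext x
    rw [map_mul, ← Complex.exp_conj]
    simp
  have hd' : Integrable (fun x => conj (f x - g x)) ν :=
    (Complex.conjLIE.integrable_comp_iff (φ := fun x => f x - g x)).mpr hd
  have hre : (fun x => (f x - g x).re) =ᵐ[ν] 0 := by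
    refine ae_eq_zero_of_integral_cexp_mul_ofReal_eq_zero hd.re fun a => ?_
    simp only [Complex.re_eq_add_conj, mul_div_assoc', mul_add]
    rw [integral_div, integral_add (integrable_cexp_mul hd a) (integrable_cexp_mul hd' a), h0, h0']
    simp
  have him : (fun x => (f x - g x).im) =ᵐ[ν] 0 := by
    refine ae_eq_zero_of_integral_cexp_mul_ofReal_eq_zero hd.im fun a => ?_
    simp only [Complex.im_eq_sub_conj, mul_div_assoc', mul_sub (Complex.exp _) (f _ - g _)]
    rw [integral_div, integral_sub (integrable_cexp_mul hd a) (integrable_cexp_mul hd' a), h0, h0']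
    simp
  filter_upwards [hre, him] with x h1 h2
  exact sub_eq_zero.mp (Complex.ext h1 h2)

/-! ### A wave function is determined by its projection up to a phase -/

theorem Wave.integrable_diagonal (w : Wave) (b : ℝ) :
    Integrable (fun x : ℝ => w.ψ (x - b) * conj (w.ψ x)) w.base := by
  have h := w.integrable_displaced 0 0 0 b
  simpa [mul_comm] using h

theorem Wave.exists_ψ_ne_zero (w : Wave) {P : ℝ → Prop} (hP : ∀ᵐ x ∂w.base, P x) :
    ∃ x, P x ∧ w.ψ x ≠ 0 := by
  by_contra! hx
  have h0 : ∫ x, ‖w.ψ x‖ ^ 2 ∂w.base = 0 := by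
    rw [integral_eq_zero_of_ae]
    filter_upwards [hP] with x h
    simp [hx x h]
  exact one_ne_zero (w.norm_one.symm.trans h0)

/-- The measure `|ψ(x)|² dx` has the characteristic function `χ(a, 0)`, so that equality of the
position distributions decides between the two kinds of wave functions. -/
theorem Wave.charFun_withDensity (w : Wave) (a : ℝ) :
    charFun (w.base.withDensity fun x => ENNReal.ofReal (‖w.ψ x‖ ^ 2)) a = w.χ a 0 := by
  have hi : Integrable (fun x => ‖w.ψ x‖ ^ 2) w.base := w.memLp.integrable_norm_pow (by norm_num)
  rw [← integral_cexp_eq_charFun, integral_withDensity_eq_integral_toReal_smul₀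
    hi.1.aemeasurable.ennreal_ofReal (Eventually.of_forall fun x => ENNReal.ofReal_lt_top),
    Wave.χ]
  congr 1
  funext x
  rw [ENNReal.toReal_ofReal (by positivity), sub_zero, Complex.mul_conj,
    Complex.normSq_eq_norm_sq, Complex.real_smul, mul_comm]

theorem Wave.χ_ne_of_base {v w : Wave} (hv : v.base = volume) (hw : w.base = Measure.count) :
    v.χ ≠ w.χ := by
  intro h
  have fin : ∀ u : Wave,
      IsFiniteMeasure (u.base.withDensity fun x => ENNReal.ofReal (‖u.ψ x‖ ^ 2)) := fun u =>
    isFiniteMeasure_withDensity_ofReal (u.memLp.integrable_norm_pow (by norm_num)).2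
  have := fin v
  have := fin w
  have hμ : v.base.withDensity (fun x => ENNReal.ofReal (‖v.ψ x‖ ^ 2)) =
      w.base.withDensity fun x => ENNReal.ofReal (‖w.ψ x‖ ^ 2) :=
    Measure.ext_of_charFun (funext fun a => by
      rw [v.charFun_withDensity, w.charFun_withDensity, h])
  obtain ⟨x, -, hx⟩ := w.exists_ψ_ne_zero (Eventually.of_forall fun _ => trivial)
  have h1 := congrArg (fun μ : Measure ℝ => μ {x}) hμ
  simp only [withDensity_apply _ (measurableSet_singleton x), hv, hw,
    Measure.restrict_singleton] at h1
  simp at h1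
  exact hx (by simpa using h1.symm)

theorem Wave.base_eq_of_χ_eq {v w : Wave} (h : v.χ = w.χ) : v.base = w.base := by
  rcases v.base_eq with hv | hv <;> rcases w.base_eq with hw | hw
  · rw [hv, hw]
  · exact absurd h (Wave.χ_ne_of_base hv hw)
  · exact absurd h.symm (Wave.χ_ne_of_base hw hv)
  · rw [hv, hw]

/-- By Fourier uniqueness along every off-diagonal, `ψ(y) ψ*(x) = φ(y) φ*(x)` for almost all
`(x, y)`; an `x` with `ψ(x) ≠ 0` then gives the phase. -/
theorem Wave.exists_ae_eq_const_mul_of_χ_eq {v w : Wave} (h : v.χ = w.χ) :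
    ∃ c : ℂ, v.ψ =ᵐ[v.base] fun x => c * w.ψ x := by
  have hb := Wave.base_eq_of_χ_eq h
  have hdiag : ∀ b : ℝ, ∀ᵐ x ∂v.base,
      v.ψ (x - b) * conj (v.ψ x) = w.ψ (x - b) * conj (w.ψ x) := fun b =>
    ae_eq_of_integral_cexp_mul_eq (v.integrable_diagonal b)
      (hb ▸ w.integrable_diagonal b) fun a => by
        have := congrFun (congrFun h a) b
        rw [Wave.χ, Wave.χ, ← hb] at this
        exact this
  have hker : ∀ᵐ x ∂v.base, ∀ᵐ y ∂v.base,
      v.ψ y * conj (v.ψ x) = w.ψ y * conj (w.ψ x) := by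
    rcases v.base_eq with hv | hv
    · -- Strongly measurable representatives make the exceptional set measurable, as Fubini needs.
      have hvm := v.memLp.1
      have hwm := w.memLp.1
      rw [← hb] at hwm
      set f := hvm.mk v.ψ with hf
      set g := hwm.mk w.ψ with hg
      have hfm : Measurable f := hvm.stronglyMeasurable_mk.measurable
      have hgm : Measurable g := hwm.stronglyMeasurable_mk.measurable
      have hvf : v.ψ =ᵐ[v.base] f := hvm.ae_eq_mk
      have hwg : w.ψ =ᵐ[v.base] g := hwm.ae_eq_mk
      rw [hv] at hdiag hvf hwg ⊢
      have hms : MeasurableSet {z : ℝ × ℝ |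
          f (z.2 - z.1) * conj (f z.2) = g (z.2 - z.1) * conj (g z.2)} := by
        have hc : Measurable (conj : ℂ → ℂ) := Complex.continuous_conj.measurable
        refine measurableSet_eq_fun ?_ ?_
        · exact (hfm.comp (measurable_snd.sub measurable_fst)).mul
            (hc.comp (hfm.comp measurable_snd))
        · exact (hgm.comp (measurable_snd.sub measurable_fst)).mul
            (hc.comp (hgm.comp measurable_snd))
      have h1 : ∀ᵐ b : ℝ, ∀ᵐ x : ℝ,
          f (x - b) * conj (f x) = g (x - b) * conj (g x) := by
        refine Eventually.of_forall fun b => ?_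
        have hq := (measurePreserving_sub_right (volume : Measure ℝ) b).quasiMeasurePreserving
        filter_upwards [hdiag b, hvf, hwg, hq.ae hvf, hq.ae hwg] with x e0 e1 e2 e3 e4
        rw [← e1, ← e2, ← e3, ← e4, e0]
      have h2 := (Measure.ae_ae_comm hms).mp h1
      filter_upwards [h2, hvf, hwg] with x hx e1 e2
      have hq := (Measure.measurePreserving_sub_left (volume : Measure ℝ) x).quasiMeasurePreserving
      filter_upwards [hq.ae hx, hvf, hwg] with y hy e3 e4
      rw [sub_sub_cancel] at hy
      rw [e1, e2, e3, e4, hy]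
    · rw [hv] at hdiag ⊢
      simp only [Measure.ae_count_iff] at hdiag ⊢
      intro x y
      have := hdiag (x - y) x
      rwa [sub_sub_cancel] at this
  obtain ⟨x, hx, hx0⟩ := v.exists_ψ_ne_zero hker
  refine ⟨conj (w.ψ x) / conj (v.ψ x), ?_⟩
  filter_upwards [hx] with y hy
  have h0 : conj (v.ψ x) ≠ 0 := (map_ne_zero _).mpr hx0
  rw [div_mul_eq_mul_div, eq_div_iff h0, hy, mul_comm]

theorem overlap_eq_zero_of_χ_eq {v v' w w' : Wave} (hv : v'.χ = v.χ) (hw : w'.χ = w.χ)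
    (h : overlap v w = 0) : overlap v' w' = 0 := by
  have hbv := Wave.base_eq_of_χ_eq hv
  have hbw := Wave.base_eq_of_χ_eq hw
  unfold overlap at h ⊢
  rw [hbv, hbw]
  split_ifs at h ⊢ with hb
  · obtain ⟨c, hc⟩ := Wave.exists_ae_eq_const_mul_of_χ_eq hv
    obtain ⟨d, hd⟩ := Wave.exists_ae_eq_const_mul_of_χ_eq hw
    rw [hbv] at hc
    rw [hbw, ← hb] at hd
    have : (fun x => conj (v'.ψ x) * w'.ψ x) =ᵐ[v.base]
        fun x => conj c * d * (conj (v.ψ x) * w.ψ x) := by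
      filter_upwards [hc, hd] with x h1 h2
      rw [h1, h2, map_mul]
      ring
    rw [integral_congr_ae this, integral_const_mul, h, mul_zero]
  · rfl

theorem Wave.shift_χ (w : Wave) (c a b : ℝ) :
    (w.shift c).χ a b = Complex.exp (-(Complex.I * (a * c))) * w.χ a b := by
  have := integral_add_right_eq_self (μ := w.base) (fun x : ℝ =>
    Complex.exp (-(Complex.I * (a * c))) *
      (Complex.exp (Complex.I * (a * x)) * (w.ψ (x - b) * conj (w.ψ x)))) c
  rw [Wave.χ, Wave.χ, ← integral_const_mul, ← this]
  change ∫ x : ℝ, Complex.exp (Complex.I * (a * x)) *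
    (w.ψ (x - b + c) * conj (w.ψ (x + c))) ∂w.base = _
  congr 1
  funext x
  have e : x + c - b = x - b + c := by ring
  have e' : Complex.exp (Complex.I * (a * x)) =
      Complex.exp (-(Complex.I * (a * c))) * Complex.exp (Complex.I * (a * (x + c : ℝ))) := by
    rw [← Complex.exp_add]
    congr 1
    push_cast
    ring
  rw [e, e', mul_assoc]

/-! ### Localised states -/

theorem ket_χ (x a b : ℝ) :
    (ket x).χ a b = if b = 0 then Complex.exp (Complex.I * (a * x)) else 0 := by
  have h : (fun y : ℝ => Complex.exp (Complex.I * (a * y)) *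
      ((Pi.single x 1 : ℝ → ℂ) (y - b) * conj ((Pi.single x 1 : ℝ → ℂ) y))) =
      Set.indicator {x} (fun _ => if b = 0 then Complex.exp (Complex.I * (a * x)) else 0) := by
    funext y
    by_cases hy : y = x
    · subst hy
      by_cases hb : b = 0
      · simp [hb]
      · simp [hb]
    · simp [hy]
  change ∫ y : ℝ, Complex.exp (Complex.I * (a * y)) *
      ((Pi.single x 1 : ℝ → ℂ) (y - b) * conj ((Pi.single x 1 : ℝ → ℂ) y)) ∂Measure.count = _
  rw [h, integral_indicator (measurableSet_singleton x)]
  simp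

theorem overlap_ket_eq_zero_iff {x y : ℝ} : overlap (ket x) (ket y) = 0 ↔ x ≠ y := by
  have h : (fun z : ℝ => conj ((Pi.single x 1 : ℝ → ℂ) z) * (Pi.single y 1 : ℝ → ℂ) z) =
      Set.indicator {x} (fun _ => if x = y then 1 else 0) := by
    funext z
    by_cases hz : z = x
    · subst hz
      simp [Pi.single_apply]
    · simp [hz]
  have h' : overlap (ket x) (ket y) =
      ∫ z : ℝ, conj ((Pi.single x 1 : ℝ → ℂ) z) * (Pi.single y 1 : ℝ → ℂ) z ∂Measure.count := by
    rw [overlap]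
    exact if_pos rfl
  rw [h', h, integral_indicator (measurableSet_singleton x)]
  simp

theorem Distinguishable.ne {ρ ρ' : Density} (h : Distinguishable ρ ρ') : ρ.χ ≠ ρ'.χ := by
  intro he
  obtain ⟨A, -, h1, h2⟩ := h (1 / 4) (by norm_num)
  have : ρ.expect A = ρ'.expect A := by simp only [Density.expect, he]
  rw [this] at h1
  linarith

/-! ### Sharp positions -/

theorem tendsto_mul_arg_cexp (x : ℝ) :
    Tendsto (fun n : ℕ => ((n : ℝ) + 1) *
      (Complex.exp (Complex.I * ((1 / ((n : ℝ) + 1) : ℝ) * x))).arg) atTop (𝓝 x) := by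
  have h0 : Tendsto (fun n : ℕ => 1 / ((n : ℝ) + 1) * x) atTop (𝓝 0) := by
    simpa using (tendsto_one_div_add_atTop_nhds_zero_nat (𝕜 := ℝ)).mul_const x
  have h1 := h0.eventually (Ioo_mem_nhds (neg_neg_of_pos Real.pi_pos) Real.pi_pos)
  refine tendsto_const_nhds.congr' ?_
  filter_upwards [h1] with n hn
  have hn0 : (n : ℝ) + 1 ≠ 0 := by positivity
  have e : Complex.exp (Complex.I * ((1 / ((n : ℝ) + 1) : ℝ) * x)) =
      Complex.cos ((1 / ((n : ℝ) + 1) * x : ℝ) : ℂ) +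
        Complex.sin ((1 / ((n : ℝ) + 1) * x : ℝ) : ℂ) * Complex.I := by
    rw [← Complex.exp_mul_I, mul_comm]
    push_cast
    rfl
  rw [e, Complex.arg_cos_add_sin_mul_I ⟨hn.1, hn.2.le⟩]
  field_simp

/-- If `|φ(s)| = 1`, the phase `e^{isx}` is almost surely constant; along `s = 1/(n+1)` these
phases determine `x`. -/
theorem exists_charFun_eq_cexp {μ : Measure ℝ} [IsProbabilityMeasure μ]
    (h : ∀ᶠ s in 𝓝 (0 : ℝ), ‖charFun μ s‖ = 1) :
    ∃ x : ℝ, ∀ a : ℝ, charFun μ a = Complex.exp (Complex.I * (a * x)) := by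
  have hconst : ∀ s : ℝ, ‖charFun μ s‖ = 1 →
      ∃ z : ℂ, ∀ᵐ y : ℝ ∂μ, Complex.exp (Complex.I * (s * y)) = z := by
    intro s hs
    rcases ae_eq_const_or_norm_integral_lt_of_norm_le_const (μ := μ) (C := 1)
      (f := fun y : ℝ => Complex.exp (Complex.I * (s * y)))
      (Eventually.of_forall fun y => (norm_exp_I_mul s y).le) with h1 | h1
    · exact ⟨_, h1⟩
    · rw [integral_cexp_eq_charFun, hs] at h1
      simp at h1
  choose! z hz using hconst
  have hev : ∀ᶠ n : ℕ in atTop, ‖charFun μ (1 / ((n : ℝ) + 1))‖ = 1 :=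
    (tendsto_one_div_add_atTop_nhds_zero_nat (𝕜 := ℝ)).eventually h
  obtain ⟨n₀, hn₀⟩ := eventually_atTop.mp hev
  have hall : ∀ᵐ y : ℝ ∂μ, ∀ n : ℕ, n₀ ≤ n →
      Complex.exp (Complex.I * ((1 / ((n : ℝ) + 1) : ℝ) * y)) = z (1 / ((n : ℝ) + 1)) := by
    refine ae_all_iff.mpr fun n => ?_
    by_cases hn : n₀ ≤ n
    · filter_upwards [hz _ (hn₀ n hn)] with y hy _ using hy
    · exact Eventually.of_forall fun y hn' => absurd hn' hn
  obtain ⟨x, hx⟩ := hall.exists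
  have hae : ∀ᵐ y ∂μ, y = x := by
    filter_upwards [hall] with y hy
    refine tendsto_nhds_unique (tendsto_mul_arg_cexp y)
      ((tendsto_mul_arg_cexp x).congr' ?_)
    filter_upwards [eventually_ge_atTop n₀] with n hn
    rw [hx n hn, hy n hn]
  refine ⟨x, fun a => ?_⟩
  rw [← integral_cexp_eq_charFun]
  have : (fun y : ℝ => Complex.exp (Complex.I * (a * y))) =ᵐ[μ]
      fun _ => Complex.exp (Complex.I * (a * x)) := by
    filter_upwards [hae] with y hy
    rw [hy]
  rw [integral_congr_ae this]
  simp

theorem Density.exists_charFun (ρ : Density) :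
    ∃ μ : Measure ℝ, IsProbabilityMeasure μ ∧ ∀ a : ℝ, ρ.χ a 0 = charFun μ a := by
  obtain ⟨μ, h, hχ⟩ := ρ.law
  exact ⟨μ, h, fun a => by rw [hχ, integral_cexp_eq_charFun]⟩

@[simp] theorem Density.χ_zero_zero (ρ : Density) : ρ.χ 0 0 = 1 := by
  obtain ⟨μ, h, hχ⟩ := ρ.exists_charFun
  simp [hχ]

theorem Density.χ_neg_zero (ρ : Density) (a : ℝ) : ρ.χ (-a) 0 = conj (ρ.χ a 0) := by
  obtain ⟨μ, h, hχ⟩ := ρ.exists_charFun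
  rw [hχ, hχ, charFun_neg]

theorem Density.norm_χ_zero_le (ρ : Density) (a : ℝ) : ‖ρ.χ a 0‖ ≤ 1 := by
  obtain ⟨μ, h, hχ⟩ := ρ.exists_charFun
  rw [hχ]
  exact norm_charFun_le_one (μ := μ) a

theorem Density.continuous_χ_zero (ρ : Density) : Continuous fun a => ρ.χ a 0 := by
  obtain ⟨μ, h, hχ⟩ := ρ.exists_charFun
  simp only [hχ]
  exact continuous_charFun

theorem eq_zero_of_forall_zero_le_one_add_mul {w : ℂ} (h : ∀ t : ℝ, 0 ≤ 1 + (t : ℂ) * w) :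
    w = 0 := by
  have him : w.im = 0 := by
    have := (Complex.le_def.mp (h 1)).2
    simpa using this.symm
  have hre : w.re = 0 := by
    by_contra hne
    have := (Complex.le_def.mp (h (-2 / w.re))).1
    have e : (1 + ((-2 / w.re : ℝ) : ℂ) * w).re = -1 := by
      rw [Complex.add_re, Complex.re_ofReal_mul, div_mul_cancel₀ _ hne, Complex.one_re]
      norm_num
    rw [e] at this
    norm_num at this
  exact Complex.ext hre him

/-- The Cauchy–Schwarz inequality for the null vector `e^{iaX} - e^{iax}`: a state with a sharp
position is multiplicative on the operators `e^{iaX}`, from both sides. -/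
theorem Density.χ_of_sharp_position (ρ : Density) {x : ℝ}
    (h : ∀ a : ℝ, ρ.χ a 0 = Complex.exp (Complex.I * (a * x))) (a b c : ℝ) :
    Complex.exp (Complex.I * ((a + c) * -b)) * ρ.χ (a + c) b =
      Complex.exp (Complex.I * (a * x)) * (Complex.exp (Complex.I * (c * -b)) * ρ.χ c b) ∧
    ρ.χ (-c - a) (-b) = Complex.exp (-(Complex.I * (a * x))) * ρ.χ (-c) (-b) := by
  set e := Complex.exp (Complex.I * (a * x)) with he
  have hē : conj e = Complex.exp (-(Complex.I * (a * x))) := by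
    rw [he, ← Complex.exp_conj]
    simp
  have hee : e * conj e = 1 := by
    rw [hē, he, ← Complex.exp_add, add_neg_cancel, Complex.exp_zero]
  have hna : ρ.χ (-a) 0 = conj e := by rw [ρ.χ_neg_zero, h]
  set P := Complex.exp (Complex.I * ((a + c) * -b)) * ρ.χ (a + c) b -
    e * (Complex.exp (Complex.I * (c * -b)) * ρ.χ c b) with hP
  set Q := ρ.χ (-c - a) (-b) - conj e * ρ.χ (-c) (-b) with hQ
  have key : ∀ (z : ℂ) (t : ℝ), 0 ≤ conj z * z + t * (conj z * P + z * Q) := by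
    intro z t
    have hpos := ρ.pos 3 ![z, t, -(t * e)] ![-c, a, 0] ![-b, 0, 0]
    refine hpos.trans_eq ?_
    simp only [Fin.sum_univ_three, Matrix.cons_val_zero, Matrix.cons_val_one, Matrix.cons_val,
      sub_self, sub_neg_eq_add, zero_sub, sub_zero, neg_neg, neg_zero, ρ.χ_zero_zero, hna, h a, ← he,
      Complex.ofReal_zero, Complex.ofReal_neg, mul_zero, zero_mul, Complex.exp_zero, map_neg,
      map_mul, Complex.conj_ofReal]
    rw [hP, hQ]
    linear_combination (t : ℂ) ^ 2 * (-1) * hee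
  have h1 : P + Q = 0 := eq_zero_of_forall_zero_le_one_add_mul fun t => by
    simpa using key 1 t
  have h2 : -(Complex.I * P) + Complex.I * Q = 0 := eq_zero_of_forall_zero_le_one_add_mul fun t => by
    simpa using key Complex.I t
  have h3 : P = Q := by
    have : Complex.I * (Q - P) = 0 := by rw [← h2]; ring
    exact (sub_eq_zero.mp ((mul_eq_zero.mp this).resolve_left Complex.I_ne_zero)).symm
  have hQ0 : Q = 0 := by
    rw [h3] at h1
    exact add_self_eq_zero.mp h1
  have hP0 : P = 0 := h3.trans hQ0
  exact ⟨sub_eq_zero.mp hP0, hē ▸ sub_eq_zero.mp hQ0⟩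

/-- A sharp position forces the position eigenstate. Comparing the action of `e^{iaX}` from the two
sides of `T_b` gives `χ(c, b) = e^{iab} χ(c, b)` for all `a`. -/
theorem Density.χ_eq_ket_of_sharp_position (ρ : Density) {x : ℝ}
    (h : ∀ a : ℝ, ρ.χ a 0 = Complex.exp (Complex.I * (a * x))) : ρ.χ = (ket x).χ := by
  funext c b
  rw [ket_χ]
  split_ifs with hb
  · rw [hb, h]
  · have hb' : (b : ℂ) ≠ 0 := Complex.ofReal_ne_zero.mpr hb
    set a : ℝ := Real.pi / b with ha
    have h1 := (ρ.χ_of_sharp_position h a b c).1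
    have h2 := (ρ.χ_of_sharp_position h (-a) (-b) (-c)).2
    simp only [neg_neg, sub_neg_eq_add, Complex.ofReal_neg, neg_mul, mul_neg] at h2
    rw [add_comm c a] at h2
    rw [h2] at h1
    -- `a = π / b` makes `e^{-iab} = -1`.
    have e1 : Complex.exp (Complex.I * ((a + c) * -b)) =
        -Complex.exp (Complex.I * (c * -b)) := by
      have : Complex.I * (((a : ℂ) + c) * -b) = Complex.I * (c * -b) - Real.pi * Complex.I := by
        rw [ha]
        push_cast
        field_simp
        ring
      rw [this, Complex.exp_sub, Complex.exp_pi_mul_I, div_neg, div_one]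
    rw [e1] at h1
    have h3 : (2 : ℂ) * (Complex.exp (Complex.I * (c * -b)) *
        (Complex.exp (Complex.I * (a * x)) * ρ.χ c b)) = 0 := by
      linear_combination -h1
    simpa using h3

/-- The effect `(1 + cos (a (X - x))) / 2` with `a (y - x) = π` is certain at `x` and impossible
at `y`. -/
theorem distinguishable_ket {x y : ℝ} (hxy : x ≠ y) :
    Distinguishable (ket x).proj (ket y).proj := by
  have hyx : y - x ≠ 0 := sub_ne_zero.mpr hxy.symm
  set a : ℝ := Real.pi / (y - x) with ha
  set A : (ℝ × ℝ) →₀ ℂ := Finsupp.single (0, 0) (1 / 2) +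
    (Finsupp.single (a, 0) (Complex.exp (-(Complex.I * (a * x))) / 4) +
      Finsupp.single (-a, 0) (Complex.exp (Complex.I * (a * x)) / 4)) with hA
  have hexp : ∀ σ : Density, σ.expect A =
      ((1 / 2 + (Complex.exp (-(Complex.I * (a * x))) * σ.χ a 0).re / 2 : ℝ) : ℂ) := by
    intro σ
    have hs : σ.expect A = 1 / 2 * σ.χ 0 0 +
        (Complex.exp (-(Complex.I * (a * x))) / 4 * σ.χ a 0 +
          Complex.exp (Complex.I * (a * x)) / 4 * σ.χ (-a) 0) := by
      rw [Density.expect, hA, Finsupp.sum_add_index', Finsupp.sum_add_index',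
        Finsupp.sum_single_index, Finsupp.sum_single_index, Finsupp.sum_single_index] <;>
      intros <;> ring
    have hc : Complex.exp (Complex.I * (a * x)) =
        conj (Complex.exp (-(Complex.I * (a * x)))) := by
      rw [← Complex.exp_conj]
      simp
    rw [hs, σ.χ_zero_zero, σ.χ_neg_zero, hc]
    push_cast
    rw [Complex.re_eq_add_conj, map_mul]
    ring
  have heff : IsEffect A := by
    intro σ
    have hn : |(Complex.exp (-(Complex.I * (a * x))) * σ.χ a 0).re| ≤ 1 := by
      refine (Complex.abs_re_le_norm _).trans ?_
      have : ‖Complex.exp (-(Complex.I * (a * x)))‖ = 1 := by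
        have := norm_exp_I_mul a (-x)
        simpa using this
      rw [norm_mul, this, one_mul]
      exact σ.norm_χ_zero_le a
    have := abs_le.mp hn
    rw [hexp]
    constructor
    · exact_mod_cast (by linarith : (0 : ℝ) ≤ 1 / 2 +
        (Complex.exp (-(Complex.I * (a * x))) * σ.χ a 0).re / 2)
    · exact_mod_cast (by linarith : 1 / 2 +
        (Complex.exp (-(Complex.I * (a * x))) * σ.χ a 0).re / 2 ≤ (1 : ℝ))
  have hval : ∀ u : ℝ, ((ket u).proj.expect A).re =
      1 / 2 + (Complex.exp (Complex.I * (a * (u - x)))).re / 2 := by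
    intro u
    rw [hexp, Complex.ofReal_re]
    change 1 / 2 + (Complex.exp (-(Complex.I * (a * x))) * (ket u).χ a 0).re / 2 = _
    rw [ket_χ, if_pos rfl, ← Complex.exp_add]
    congr 4
    ring
  intro ε hε
  refine ⟨A, heff, ?_, ?_⟩
  · rw [hval]
    simp
    linarith
  · have : Complex.I * ((a : ℂ) * (y - x)) = Real.pi * Complex.I := by
      have hc : (y : ℂ) - x ≠ 0 := by exact_mod_cast hyx
      rw [ha]
      push_cast
      field_simp
    rw [hval, this, Complex.exp_pi_mul_I]
    simp
    linarith

theorem exists_measurable_position {I : Type*} [MeasurableSpace I] {p : Measure I}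
    {ρ : I → Density} (hm : ∀ a b : ℝ, AEMeasurable (fun i => (ρ i).χ a b) p)
    (h : ∀ᵐ i ∂p, ∃ x, (ρ i).χ = (ket x).χ) :
    ∃ x : I → ℝ, Measurable x ∧ ∀ᵐ i ∂p, (ρ i).χ = (ket (x i)).χ := by
  obtain ⟨y, hy⟩ : ∃ y : I → ℝ, ∀ᵐ i ∂p, (ρ i).χ = (ket (y i)).χ := by
    choose! y hy using fun (i : I) (hi : ∃ x, (ρ i).χ = (ket x).χ) => hi
    exact ⟨y, h.mono hy⟩
  have hym : AEMeasurable y p := by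
    refine aemeasurable_of_tendsto_metrizable_ae atTop
      (f := fun (n : ℕ) i => ((n : ℝ) + 1) * ((ρ i).χ (1 / ((n : ℝ) + 1)) 0).arg)
      (fun n => (Complex.measurable_arg.comp_aemeasurable (hm _ _)).const_mul _) ?_
    filter_upwards [hy] with i hi
    refine (tendsto_mul_arg_cexp (y i)).congr fun n => ?_
    rw [hi, ket_χ, if_pos rfl]
  refine ⟨hym.mk y, hym.measurable_mk, ?_⟩
  filter_upwards [hy, hym.ae_eq_mk] with i h1 h2
  rw [h1, h2]

/-! ### Product states in the frame of an environment -/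

section Frames

variable {I : Type*} {N : ℕ}

/-- The vector with entry `s` at the system, `t` at the environment `E_k` and `0` elsewhere. -/
def probe (k : Fin N) (s t : ℝ) : Option (Fin N) → ℝ :=
  fun r => r.elim s fun j => if j = k then t else 0

theorem Branches.conditional_probe (D : Branches I N) (i : I) (k : Fin N) (s t s' t' : ℝ) :
    D.conditional i (probe k s t) (probe k s' t') = (D.ψ i).χ s s' * (D.ρ i k).χ t t' := by
  change (D.ψ i).χ s s' *
    ∏ j, (D.ρ i j).χ (if j = k then t else 0) (if j = k then t' else 0) = _
  rw [Finset.prod_eq_single k (fun j _ hj => by simp [hj]) (by simp)]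
  simp

theorem frameMapT_probe (k : Fin N) (s t : ℝ) :
    frameMapT k (probe k s t) = probe k s (-(s + t)) := by
  funext r
  cases r with
  | none => simp [frameMapT, probe]
  | some j =>
    by_cases hj : j = k <;> simp [frameMapT, probe, hj, Fintype.sum_option]

theorem frameMap_probe_zero (k : Fin N) : frameMap k (probe k 0 0) = probe k 0 0 := by
  funext r
  cases r <;> simp [frameMap, probe]

/-- The factors of a product state are its marginals. -/
theorem Branches.factors_eq_of_conditional_eq {D E : Branches I N} {i : I}
    (h : D.conditional i = E.conditional i) (k : Fin N) :
    (D.ψ i).χ = (E.ψ i).χ ∧ (D.ρ i k).χ = (E.ρ i k).χ := by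
  have h' : ∀ s t s' t' : ℝ, (D.ψ i).χ s s' * (D.ρ i k).χ t t' =
      (E.ψ i).χ s s' * (E.ρ i k).χ t t' := by
    intro s t s' t'
    rw [← D.conditional_probe, h, E.conditional_probe]
  constructor
  · funext s s'
    simpa using h' s 0 s' 0
  · funext t t'
    have h1 : (D.ψ i).χ 0 0 = 1 := (D.ψ i).proj.χ_zero_zero
    have h2 : (E.ψ i).χ 0 0 = 1 := (E.ψ i).proj.χ_zero_zero
    simpa [h1, h2] using h' 0 t 0 t'

/-- If the conditional state is still a product state in the frame of `E_k`, then `E_k` is localised.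
In that frame `S` and `C` have the positions `x_S - x_k` and `-x_k`, and these are independent only
if `x_k` is sharp: the characteristic functions satisfy
`φ_S(s) φ_k(-(s + t)) = φ_S(s) φ_k(-s) φ_k(-t)`, and `φ_S(s) ≠ 0` for small `s`. -/
theorem Branches.exists_position_of_toFrame_eq {D E : Branches I N} {i : I} {k : Fin N}
    (h : toFrame (some k) (D.conditional i) = E.conditional i) :
    ∃ x, (D.ρ i k).χ = (ket x).χ := by
  have h' : ∀ s t : ℝ, (D.ψ i).proj.χ s 0 * (D.ρ i k).χ (-(s + t)) 0 =
      (E.ψ i).proj.χ s 0 * (E.ρ i k).χ t 0 := by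
    intro s t
    have h1 := congrFun (congrFun h (probe k s t)) (probe k 0 0)
    change D.conditional i (frameMapT k _) (frameMap k _) = _ at h1
    rwa [frameMapT_probe, frameMap_probe_zero, D.conditional_probe, E.conditional_probe] at h1
  have hS : ∀ s, (E.ψ i).proj.χ s 0 = (D.ψ i).proj.χ s 0 * (D.ρ i k).χ (-s) 0 := fun s => by
    simpa using (h' s 0).symm
  have hC : ∀ t, (E.ρ i k).χ t 0 = (D.ρ i k).χ (-t) 0 := fun t => by
    simpa using (h' 0 t).symm
  have hev : ∀ᶠ s in 𝓝 (0 : ℝ), (D.ψ i).proj.χ s 0 ≠ 0 :=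
    (D.ψ i).proj.continuous_χ_zero.continuousAt.eventually_ne (by simp)
  have hnorm : ∀ᶠ s in 𝓝 (0 : ℝ), ‖(D.ρ i k).χ s 0‖ = 1 := by
    filter_upwards [hev] with s hs
    have h1 := h' s (-s)
    rw [hS, hC, mul_assoc] at h1
    have h2 := mul_left_cancel₀ hs h1
    rw [add_neg_cancel, neg_zero, neg_neg, Density.χ_zero_zero, Density.χ_neg_zero,
      Complex.conj_mul'] at h2
    have h3 : ‖(D.ρ i k).χ s 0‖ ^ 2 = 1 := by exact_mod_cast h2.symm
    exact (pow_eq_one_iff_of_nonneg (norm_nonneg _) two_ne_zero).mp h3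
  obtain ⟨μ, hμ, hχ⟩ := (D.ρ i k).exists_charFun
  simp only [hχ] at hnorm
  obtain ⟨x, hx⟩ := exists_charFun_eq_cexp hnorm
  exact ⟨x, (D.ρ i k).χ_eq_ket_of_sharp_position fun a => by rw [hχ, hx]⟩

/-- The family `localised ψ x` as seen from `E_k`: the system is shifted by `x_k`, the laboratory
(at the index `k`) sits at `-x_k`, and `E_j` sits at `x_j - x_k`. -/
def Branches.localisedFrom (k : Fin N) (ψ : I → Wave) (x : Fin N → I → ℝ) : Branches I N where
  ψ := fun i => (ψ i).shift (x k i)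
  ρ := fun i j => (ket (if j = k then -x k i else x j i - x k i)).proj

theorem prod_ket_χ (y a b : Fin N → ℝ) :
    ∏ j, (ket (y j)).χ (a j) (b j) =
      if b = 0 then Complex.exp (Complex.I * (∑ j, a j * y j : ℝ)) else 0 := by
  split_ifs with hb
  · simp only [ket_χ, hb, Pi.zero_apply, if_true]
    rw [← Complex.exp_sum, ← Finset.mul_sum]
    push_cast
    rfl
  · obtain ⟨j, hj⟩ := Function.ne_iff.mp hb
    exact Finset.prod_eq_zero (Finset.mem_univ j) (by rw [ket_χ, if_neg (by simpa using hj)])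

theorem Branches.toFrame_localised (k : Fin N) (ψ : I → Wave) (x : Fin N → I → ℝ) (i : I) :
    toFrame (some k) ((localised ψ x).conditional i) = (localisedFrom k ψ x).conditional i := by
  funext a b
  change (ψ i).χ (frameMapT k a none) (frameMap k b none) *
      ∏ j, (ket (x j i)).χ (frameMapT k a (some j)) (frameMap k b (some j)) =
    ((ψ i).shift (x k i)).χ (a none) (b none) *
      ∏ j, (ket (if j = k then -x k i else x j i - x k i)).χ (a (some j)) (b (some j))
  rw [prod_ket_χ (fun j => x j i), prod_ket_χ, Wave.shift_χ]
  have hb : (fun j => frameMap k b (some j)) = 0 ↔ (fun j => b (some j)) = 0 := by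
    constructor
    · intro h
      have hk : b (some k) = 0 := by simpa [frameMap] using congrFun h k
      funext j
      by_cases hj : j = k
      · rw [hj, hk, Pi.zero_apply]
      · simpa [frameMap, hj, hk] using congrFun h j
    · intro h
      have h' : ∀ j, b (some j) = 0 := fun j => congrFun h j
      funext j
      simp [frameMap, h']
  by_cases h : (fun j => b (some j)) = 0
  · rw [if_pos h, if_pos (hb.mpr h)]
    have hk : b (some k) = 0 := congrFun h k
    have hdot := frameMapT_dot k a fun r => r.elim 0 fun j => x j i
    simp only [Fintype.sum_option, Option.elim, frameMap, Option.some.injEq, mul_zero, zero_add,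
      reduceCtorEq, if_false, zero_sub] at hdot
    rw [hdot, mul_comm (Complex.exp _) ((ψ i).χ _ _), mul_assoc, ← Complex.exp_add]
    simp only [frameMapT, frameMap, reduceCtorEq, if_false, hk, sub_zero]
    congr 2
    push_cast
    ring
  · rw [if_neg h, if_neg (mt hb.mp h), mul_zero, mul_zero]

theorem Branches.conditional_eq_localised {D : Branches I N} {x : Fin N → I → ℝ} {i : I}
    (h : ∀ j, (D.ρ i j).χ = (ket (x j i)).χ) :
    D.conditional i = (localised D.ψ x).conditional i := by
  funext a b
  change _ * _ = _ * ∏ j, (ket (x j i)).χ _ _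
  simp only [h]
  rfl

variable [MeasurableSpace I] {p : Measure I}

theorem Branches.toFrame_state_eq {F : Option (Fin N)} {D E : Branches I N}
    (h : ∀ᵐ i ∂p, toFrame F (D.conditional i) = E.conditional i) :
    toFrame F (D.state p) = E.state p := by
  have hF : ∀ a b, toFrame F (D.state p) a b = ∫ i, toFrame F (D.conditional i) a b ∂p := by
    intro a b
    cases F <;> rfl
  funext a b
  rw [hF]
  exact integral_congr_ae (h.mono fun i hi => congrFun (congrFun hi a) b)

theorem Branches.isSBS_localisedFrom {D : Branches I N} (hD : D.IsSBS p) {x : Fin N → I → ℝ}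
    (hx : ∀ j, Measurable (x j)) (k : Fin N) {G : Set I} (hG : G ∈ ae p)
    (h : ∀ i ∈ G, ∀ i' ∈ G, i ≠ i' → x k i ≠ x k i' ∧
      overlap ((D.ψ i).shift (x k i)) ((D.ψ i').shift (x k i')) = 0 ∧
      ∀ j, j ≠ k → x j i - x k i ≠ x j i' - x k i') :
    (localisedFrom k D.ψ x).IsSBS p := by
  refine ⟨fun a b => ?_, fun j a b => ?_, G, hG, fun i hi i' hi' hne => ?_⟩
  · change AEMeasurable (fun i => ((D.ψ i).shift (x k i)).χ a b) p
    simp only [Wave.shift_χ]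
    have hk := hx k
    exact AEMeasurable.mul
      (by fun_prop : Measurable fun i => Complex.exp (-(Complex.I * (a * x k i)))).aemeasurable
      (hD.1 a b)
  · change AEMeasurable (fun i => (ket (if j = k then -x k i else x j i - x k i)).χ a b) p
    simp only [ket_χ]
    have hk := hx k
    have hj := hx j
    split_ifs <;> fun_prop
  · obtain ⟨h1, h2, h3⟩ := h i hi i' hi' hne
    refine ⟨h2, fun j => distinguishable_ket ?_⟩
    split_ifs with hj
    · exact fun he => h1 (neg_injective he)
    · exact h3 j hj

end Frames

end QRF

end

/-! ### Objectivity in all frames -/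

theorem mainTheorem2 {I : Type*} [MeasurableSpace I] (p : MeasureTheory.Measure I)
    [MeasureTheory.IsProbabilityMeasure p] (N : ℕ) (D : QRF.Branches I N) (hD : D.IsSBS p) :
    (∀ F : Option (Fin N), D.ObjectiveIn p F) ↔
      ∃ x : Fin N → I → ℝ, (∀ j, Measurable (x j)) ∧
        D.state p = (QRF.Branches.localised D.ψ x).state p ∧
        ∃ G ∈ MeasureTheory.ae p,
          (∀ i ∈ G, D.conditional i = (QRF.Branches.localised D.ψ x).conditional i) ∧
          ∀ i ∈ G, ∀ i' ∈ G, i ≠ i' →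
            QRF.overlap (D.ψ i) (D.ψ i') = 0 ∧
            (∀ j, QRF.overlap (QRF.ket (x j i)) (QRF.ket (x j i')) = 0) ∧
            (∀ j, QRF.overlap ((D.ψ i).shift (x j i)) ((D.ψ i').shift (x j i')) = 0) ∧
            (∀ j k, j ≠ k →
              QRF.overlap (QRF.ket (x j i - x k i)) (QRF.ket (x j i' - x k i')) = 0) := by
  open QRF in
  constructor
  · intro h
    choose E hE using fun k => h (some k)
    obtain ⟨G₀, hG₀, hdist⟩ := hD.2.2
    choose G hG hEdist using fun k => (hE k).1.2.2
    have hpos : ∀ j, ∃ x : I → ℝ, Measurable x ∧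
        ∀ᵐ i ∂p, (D.ρ i j).χ = (ket (x i)).χ := fun j =>
      exists_measurable_position (hD.2.1 j)
        ((hE j).2.2.mono fun i hi => Branches.exists_position_of_toFrame_eq hi)
    choose x hxm hx using hpos
    -- The indices at which all the almost sure statements hold at once.
    have hall : ∀ᵐ i ∂p, i ∈ G₀ ∧ ∀ j, (D.ρ i j).χ = (ket (x j i)).χ ∧ i ∈ G j ∧
        toFrame (some j) (D.conditional i) = (E j).conditional i := by
      have h1 := ae_all_iff.mpr fun j => ((hx j).and (hG j)).and (hE j).2.2
      filter_upwards [hG₀, h1] with i h0 hi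
      exact ⟨h0, fun j => ⟨(hi j).1.1, (hi j).1.2, (hi j).2⟩⟩
    have hloc : ∀ i, (∀ j, (D.ρ i j).χ = (ket (x j i)).χ) →
        D.conditional i = (Branches.localised D.ψ x).conditional i :=
      fun i => Branches.conditional_eq_localised
    refine ⟨x, hxm, ?_, _, hall, fun i hi => hloc i fun j => (hi.2 j).1,
      fun i hi i' hi' hne => ?_⟩
    · exact Branches.toFrame_state_eq (F := none)
        (hall.mono fun i hi => hloc i fun j => (hi.2 j).1)
    · have hfac : ∀ i, (i ∈ G₀ ∧ ∀ j, (D.ρ i j).χ = (ket (x j i)).χ ∧ i ∈ G j ∧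
          toFrame (some j) (D.conditional i) = (E j).conditional i) → ∀ k j,
          ((D.ψ i).shift (x k i)).χ = ((E k).ψ i).χ ∧
          (ket (if j = k then -x k i else x j i - x k i)).χ = ((E k).ρ i j).χ := by
        intro i hi k j
        have h1 := (hi.2 k).2.2
        rw [hloc i fun j => (hi.2 j).1, Branches.toFrame_localised] at h1
        exact Branches.factors_eq_of_conditional_eq h1 j
      obtain ⟨h1, h2⟩ := hdist i hi.1 i' hi'.1 hne
      refine ⟨h1, fun j => overlap_ket_eq_zero_iff.mpr fun he => (h2 j).ne ?_, fun j => ?_,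
        fun j k hjk => overlap_ket_eq_zero_iff.mpr fun he => ?_⟩
      · rw [(hi.2 j).1, (hi'.2 j).1, he]
      · exact overlap_eq_zero_of_χ_eq (hfac i hi j j).1 (hfac i' hi' j j).1
          (hEdist j i (hi.2 j).2.1 i' (hi'.2 j).2.1 hne).1
      · refine ((hEdist k i (hi.2 k).2.1 i' (hi'.2 k).2.1 hne).2 j).ne ?_
        rw [← (hfac i hi k j).2, ← (hfac i' hi' k j).2, if_neg hjk, if_neg hjk, he]
  · rintro ⟨x, hxm, -, G, hG, hcond, horth⟩ F
    cases F with
    | none => exact ⟨D, hD, rfl, Filter.Eventually.of_forall fun _ => rfl⟩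
    | some k =>
      have hcond' : ∀ᵐ i ∂p, toFrame (some k) (D.conditional i) =
          (Branches.localisedFrom k D.ψ x).conditional i := by
        filter_upwards [hG] with i hi
        rw [hcond i hi, Branches.toFrame_localised]
      refine ⟨Branches.localisedFrom k D.ψ x,
        Branches.isSBS_localisedFrom hD hxm k hG fun i hi i' hi' hne => ?_,
        Branches.toFrame_state_eq hcond', hcond'⟩
      obtain ⟨-, h2, h3, h4⟩ := horth i hi i' hi' hne
      exact ⟨overlap_ket_eq_zero_iff.mp (h2 k), h3 k,
        fun j hj => overlap_ket_eq_zero_iff.mp (h4 j k hj)⟩
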